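/- Let $n,N\ge 1$, $F_1\in\mathbb{R}^{n\times n}$, $F_2\in\mathbb{R}^{n\times n^2}$, and suppose $F_1=W\Lambda W^{-1}$ with $W\in\mathbb{C}^{n\times n}$ invertible and $\Lambda=\operatorname{diag}(\lambda_1,\dots,\lambda_n)$, $\operatorname{Re}\lambda_k\le 0$ for all $k$. Assume that the resonance parameter $$\Delta:=\inf_{1\le k\le n}\ \inf_{\substack{m_1,\dots,m_n\in\mathbb{Z}_{\ge0}\\ m_1+\cdots+m_n\ge 2}}\Big|\lambda_k-\sum_{j=1}^n m_j\lambda_j\Big|$$ is positive. Let $T\ge 0$, let $x:[0,T]\to\mathbb{R}^n$ solve $x'=F_1x+F_2\,(x\otimes x)$, $x(0)=x_{in}$, and suppose $\|x(t)\|_1\le\mu$ for all $t\in[0,T]$. Let $y_j:[0,T]\to\mathbb{R}^{n^j}$, $1\le j\le N$, solve the level-$N$ Carleman system $$y_j'=A_{j,j}\,y_j+A_{j,j+1}\,y_{j+1}\ (1\le j<N),\qquad y_N'=A_{N,N}\,y_N,\qquad y_j(0)=x_{in}^{\otimes j},$$ where $A_{j,j}=\sum_{i=0}^{j-1}I^{\otimes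 i}\otimes F_1\otimes I^{\otimes(j-1-i)}$ and $A_{j,j+1}=\sum_{i=0}^{j-1}I^{\otimes i}\otimes F_2\otimes I^{\otimes(j-1-i)}$. With $\|\cdot\|_1$ the $\ell^1$ vector norm and the induced matrix norm, put $\kappa_1(W)=\|W\|_1\|W^{-1}\|_1$ and $$C=\kappa_1(W)\,\|F_2\|_1\,\mu^2,\qquad \mathsf R_r=\frac{4e\,\mu\,\kappa_1(W)\,\|F_2\|_1}{\Delta}.$$ Then, if $\mathsf R_r\le 1$, $$\|x(T)-y_1(T)\|_1\le N\,C\,T\,\mathsf R_r^{\,N-1},$$ and, without any restriction on $\mathsf R_r$, $$\|x(T)-y_1(T)\|_1\le N\,C\,T\,\big(\kappa_1(W)\,\mathsf R_r\big)^{N-1}.$$ Neither $\mathsf R_r$ nor $\kappa_1(W)\mathsf R_r$ depends on $T$ other than through the uniform bound $\mu$. -/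

import Mathlib

namespace Carleman

noncomputable section

/-- The `ℓ¹` norm of a finite vector. -/
def vecNorm1 {𝕜 ι : Type*} [RCLike 𝕜] [Fintype ι] (v : ι → 𝕜) : ℝ :=
  ∑ i, ‖v i‖

/-- The matrix norm induced by the `ℓ¹` vector norms. -/
def matNorm1 {𝕜 ι κ : Type*} [RCLike 𝕜] [Fintype ι] [Fintype κ] (A : Matrix ι κ 𝕜) : ℝ :=
  sInf {c : ℝ | 0 ≤ c ∧ ∀ v : κ → 𝕜, vecNorm1 (A.mulVec v) ≤ c * vecNorm1 v}

/-- The condition number of a square matrix in the induced `ℓ¹` norm. -/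
def condNum1 {n : ℕ} (W : Matrix (Fin n) (Fin n) ℂ) : ℝ :=
  matNorm1 W * matNorm1 W⁻¹

/-- The resonance parameter of a family of eigenvalues: the infimum of `|λ_k - ∑ m_j λ_j|` over all
`k` and all multi-indices `m` of nonnegative integers with `∑ m_j ≥ 2`. -/
def resonanceParam {n : ℕ} (lam : Fin n → ℂ) : ℝ :=
  sInf {d : ℝ | ∃ (k : Fin n) (m : Fin n → ℕ), 2 ≤ ∑ j, m j ∧
    d = ‖lam k - ∑ j, (m j : ℂ) * lam j‖}

/-- The `j`-th tensor power of `v`, with coordinates indexed by multi-indices `Fin j → Fin n`. -/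
def tensorPow {n : ℕ} (v : Fin n → ℝ) (j : ℕ) : (Fin j → Fin n) → ℝ :=
  fun a => ∏ k, v (a k)

/-- The tensor square `v ⊗ v`, with coordinates indexed by pairs. -/
def tensorSq {n : ℕ} (v : Fin n → ℝ) : Fin n × Fin n → ℝ :=
  fun p => v p.1 * v p.2

/-- The diagonal block `A_{j,j} = ∑ i, I^{⊗ i} ⊗ F₁ ⊗ I^{⊗ (j-1-i)}`, `i = 0, …, j-1`. -/
def diagBlock {n : ℕ} (F₁ : Matrix (Fin n) (Fin n) ℝ) (j : ℕ) :
    Matrix (Fin j → Fin n) (Fin j → Fin n) ℝ :=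
  fun a b => ∑ i : Fin j, F₁ (a i) (b i) *
    ∏ k : Fin j, if k = i then 1 else (1 : Matrix (Fin n) (Fin n) ℝ) (a k) (b k)

/-- The superdiagonal block `A_{j,j+1} = ∑ i, I^{⊗ i} ⊗ F₂ ⊗ I^{⊗ (j-1-i)}`, `i = 0, …, j-1`.
In the `i`-th summand, `F₂` takes the tensor factors `i` and `i+1` to the factor `i`, and the
factors after `i+1` move down by one place. -/
def superBlock {n : ℕ} (F₂ : Matrix (Fin n) (Fin n × Fin n) ℝ) (j : ℕ) :
    Matrix (Fin j → Fin n) (Fin (j + 1) → Fin n) ℝ :=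
  fun a b => ∑ i : Fin j, F₂ (a i) (b i.castSucc, b i.succ) *
    ∏ k : Fin j,
      if k < i then (1 : Matrix (Fin n) (Fin n) ℝ) (a k) (b k.castSucc)
      else if i < k then (1 : Matrix (Fin n) (Fin n) ℝ) (a k) (b k.succ)
      else 1

/-- `x` solves `x' = F₁ x + F₂ (x ⊗ x)` on `[0, T]` with `x(0) = xin`. -/
def IsQuadraticSolution {n : ℕ} (F₁ : Matrix (Fin n) (Fin n) ℝ)
    (F₂ : Matrix (Fin n) (Fin n × Fin n) ℝ) (xin : Fin n → ℝ) (T : ℝ)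
    (x : ℝ → Fin n → ℝ) : Prop :=
  x 0 = xin ∧ ∀ t ∈ Set.Icc 0 T,
    HasDerivWithinAt x (F₁.mulVec (x t) + F₂.mulVec (tensorSq (x t))) (Set.Icc 0 T) t

/-- The blocks `y 1, …, y N` solve the level-`N` truncated Carleman system on `[0, T]`, that is
`y_j' = A_{j,j} y_j + A_{j,j+1} y_{j+1}` for `1 ≤ j < N` and `y_N' = A_{N,N} y_N`, with
`y_j(0) = xin^{⊗ j}`. The values of `y j` for `j = 0` and `j > N` play no role. -/
def IsCarlemanSolution {n : ℕ} (F₁ : Matrix (Fin n) (Fin n) ℝ)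
    (F₂ : Matrix (Fin n) (Fin n × Fin n) ℝ) (xin : Fin n → ℝ) (N : ℕ) (T : ℝ)
    (y : (j : ℕ) → ℝ → (Fin j → Fin n) → ℝ) : Prop :=
  ∀ j, 1 ≤ j → j ≤ N → y j 0 = tensorPow xin j ∧ ∀ t ∈ Set.Icc 0 T,
    HasDerivWithinAt (y j)
      ((diagBlock F₁ j).mulVec (y j t) +
        if j < N then (superBlock F₂ j).mulVec (y (j + 1) t) else 0)
      (Set.Icc 0 T) t

/-- The first block `y_1(t)`, read as a vector indexed by `Fin n`. -/
def firstBlock {n : ℕ} (y : (j : ℕ) → ℝ → (Fin j → Fin n) → ℝ) (t : ℝ) : Fin n → ℝ :=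
  fun i => y 1 t (fun _ => i)

/-- The constant `C = κ₁(W) ‖F₂‖₁ μ²`. -/
def errConst {n : ℕ} (W : Matrix (Fin n) (Fin n) ℂ)
    (F₂ : Matrix (Fin n) (Fin n × Fin n) ℝ) (μ : ℝ) : ℝ :=
  condNum1 W * matNorm1 F₂ * μ ^ 2

/-- The rate `R_r = 4 e μ κ₁(W) ‖F₂‖₁ / Δ`. -/
def resRate {n : ℕ} (W : Matrix (Fin n) (Fin n) ℂ) (lam : Fin n → ℂ)
    (F₂ : Matrix (Fin n) (Fin n × Fin n) ℝ) (μ : ℝ) : ℝ :=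
  4 * Real.exp 1 * μ * condNum1 W * matNorm1 F₂ / resonanceParam lam

end

end Carleman

/-! Since `F₁` is real, its spectrum is closed under conjugation. The multi-index counting `λ_k`
twice and its conjugate once is therefore admissible, and it gives `Δ ≤ -2 Re λ_k`. So nonresonance
forces a spectral gap `γ = Δ/2` (`re_eigenvalue_le`), and Duhamel's formula bounds a solution of `v'
= F₁ v + g`, `v(0) = 0`, by `κ₁(W) sup‖g‖ / γ`, uniformly in time.

Expand the solution formally in the size of the initial value, `u = u₁ + u₂ + ⋯`, with `u_m`
homogeneous of degree `m`. Tensor powers of this series solve the infinite Carleman system degree by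
degree. Cutting them at degree `N` makes block `N + 1` vanish, so they solve the truncated system;
by uniqueness `y₁ = u₁ + ⋯ + u_N` (`IsCarlemanSolution.firstBlock_eq`).

The error is thus the Taylor remainder `x - (u₁ + ⋯ + u_N)`. Terms and remainders obey linear
equations with quadratic forcing by lower ones, hence Catalan-type recursions with ratio `βν`, where
`β = κ₁(W)‖F₂‖₁/γ` and `ν` bounds both `u₁` and `x` (`vecNorm1_taylor_le`, `vecNorm1_remainder_le`).
The factor `T` enters once, in the first remainder. The bound `catalan (k + 1) ≤ 4 ^ k` gives the
rate `4βν`, and the two claims come from two choices of `ν`. -/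

namespace Carleman

/-! ### The `ℓ¹` norms and the condition number. -/

section Norms

variable {𝕜 ι κ : Type*} [RCLike 𝕜] [Fintype ι] [Fintype κ]

theorem vecNorm1_nonneg (v : ι → 𝕜) : 0 ≤ vecNorm1 v :=
  Finset.sum_nonneg fun _ _ => norm_nonneg _

theorem vecNorm1_zero : vecNorm1 (0 : ι → 𝕜) = 0 := by simp [vecNorm1]

theorem vecNorm1_add_le (v w : ι → 𝕜) : vecNorm1 (v + w) ≤ vecNorm1 v + vecNorm1 w := by
  unfold vecNorm1
  rw [← Finset.sum_add_distrib]
  exact Finset.sum_le_sum fun i _ => norm_add_le _ _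

theorem vecNorm1_sub_le (v w : ι → 𝕜) : vecNorm1 (v - w) ≤ vecNorm1 v + vecNorm1 w := by
  unfold vecNorm1
  rw [← Finset.sum_add_distrib]
  exact Finset.sum_le_sum fun i _ => norm_sub_le _ _

theorem vecNorm1_sum_le {α : Type*} (s : Finset α) (f : α → ι → 𝕜) :
    vecNorm1 (∑ a ∈ s, f a) ≤ ∑ a ∈ s, vecNorm1 (f a) := by
  unfold vecNorm1
  rw [Finset.sum_comm]
  refine Finset.sum_le_sum fun i _ => ?_
  rw [Finset.sum_apply]
  exact norm_sum_le _ _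

theorem vecNorm1_tensor (v : ι → 𝕜) (w : κ → 𝕜) :
    vecNorm1 (fun p : ι × κ => v p.1 * w p.2) = vecNorm1 v * vecNorm1 w := by
  simp only [vecNorm1, norm_mul, Fintype.sum_prod_type, Finset.sum_mul_sum]

theorem vecNorm1_ofReal (v : ι → ℝ) : vecNorm1 (fun i => (v i : ℂ)) = vecNorm1 v := by
  simp [vecNorm1]

theorem matNorm1_set_nonempty (A : Matrix ι κ 𝕜) :
    {c : ℝ | 0 ≤ c ∧ ∀ v : κ → 𝕜, vecNorm1 (A.mulVec v) ≤ c * vecNorm1 v}.Nonempty := by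
  refine ⟨∑ i, ∑ j, ‖A i j‖,
    Finset.sum_nonneg fun _ _ => Finset.sum_nonneg fun _ _ => norm_nonneg _, fun v => ?_⟩
  rw [Finset.sum_mul]
  refine Finset.sum_le_sum fun i _ => ?_
  rw [Finset.sum_mul]
  refine (norm_sum_le _ _).trans (Finset.sum_le_sum fun j _ => ?_)
  rw [norm_mul]
  exact mul_le_mul_of_nonneg_left
    (Finset.single_le_sum (f := fun j => ‖v j‖) (fun _ _ => norm_nonneg _) (Finset.mem_univ j))
    (norm_nonneg _)

theorem matNorm1_nonneg (A : Matrix ι κ 𝕜) : 0 ≤ matNorm1 A :=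
  Real.sInf_nonneg fun _ hc => hc.1

theorem vecNorm1_mulVec_le (A : Matrix ι κ 𝕜) (v : κ → 𝕜) :
    vecNorm1 (A.mulVec v) ≤ matNorm1 A * vecNorm1 v := by
  rcases (vecNorm1_nonneg v).eq_or_lt with h | h
  · obtain ⟨c, -, hc⟩ := matNorm1_set_nonempty A
    simpa [← h] using hc v
  · rw [← div_le_iff₀ h]
    exact le_csInf (matNorm1_set_nonempty A) fun c hc => (div_le_iff₀ h).2 (hc.2 v)

theorem condNum1_nonneg {n : ℕ} (W : Matrix (Fin n) (Fin n) ℂ) : 0 ≤ condNum1 W :=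
  mul_nonneg (matNorm1_nonneg _) (matNorm1_nonneg _)

/-- Apply `W W⁻¹ = 1` to the all-ones vector, which is nonzero because `n > 0`. -/
theorem one_le_condNum1 {n : ℕ} (hn : 0 < n) (W : Matrix (Fin n) (Fin n) ℂ) (hW : IsUnit W.det) :
    1 ≤ condNum1 W := by
  let v : Fin n → ℂ := fun _ => 1
  have hv : 0 < vecNorm1 v := by simp [vecNorm1, v, hn]
  have h1 : vecNorm1 v ≤ condNum1 W * vecNorm1 v := by
    calc vecNorm1 v = vecNorm1 (W.mulVec (W⁻¹.mulVec v)) := by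
          rw [Matrix.mulVec_mulVec, Matrix.mul_nonsing_inv _ hW, Matrix.one_mulVec]
      _ ≤ matNorm1 W * (matNorm1 W⁻¹ * vecNorm1 v) :=
          (vecNorm1_mulVec_le _ _).trans
            (mul_le_mul_of_nonneg_left (vecNorm1_mulVec_le _ _) (matNorm1_nonneg _))
      _ = condNum1 W * vecNorm1 v := by rw [condNum1, mul_assoc]
  exact le_of_mul_le_mul_right (by simpa using h1) hv

end Norms

/-! ### Spectral gap from nonresonance, and Duhamel estimates. -/

section Spectrum

variable {n : ℕ} {F₁ : Matrix (Fin n) (Fin n) ℝ} {W : Matrix (Fin n) (Fin n) ℂ}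
  {lam : Fin n → ℂ}

/-- The eigenvalues of a diagonalizable real matrix are closed under conjugation. -/
theorem exists_eq_conj_eigenvalue (hW : IsUnit W.det)
    (hF₁ : F₁.map (fun r : ℝ => (r : ℂ)) = W * Matrix.diagonal lam * W⁻¹) (k : Fin n) :
    ∃ j, lam j = (starRingEnd ℂ) (lam k) := by
  have hchar : (F₁.charpoly).map Complex.ofRealHom =
      ∏ i, (Polynomial.X - Polynomial.C (lam i)) := by
    rw [← Matrix.charpoly_map, ← Matrix.charpoly_diagonal]
    have hu : IsUnit W := (Matrix.isUnit_iff_isUnit_det W).2 hW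
    have h := Matrix.charpoly_units_conj hu.unit (Matrix.diagonal lam)
    rw [← h]
    exact congrArg Matrix.charpoly (hF₁.trans (by simp))
  have h1 : (F₁.charpoly).aeval (lam k) = 0 := by
    rw [Polynomial.aeval_def, Polynomial.eval₂_eq_eval_map]
    change Polynomial.eval _ (F₁.charpoly.map Complex.ofRealHom) = 0
    rw [hchar, Polynomial.eval_prod]
    exact Finset.prod_eq_zero (Finset.mem_univ k) (by simp)
  have h2 : (F₁.charpoly).aeval ((starRingEnd ℂ) (lam k)) = 0 := by
    rw [Polynomial.aeval_conj, h1, map_zero]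
  rw [Polynomial.aeval_def, Polynomial.eval₂_eq_eval_map] at h2
  change Polynomial.eval _ (F₁.charpoly.map Complex.ofRealHom) = 0 at h2
  rw [hchar, Polynomial.eval_prod, Finset.prod_eq_zero_iff] at h2
  obtain ⟨j, -, hj⟩ := h2
  exact ⟨j, (sub_eq_zero.1 (by simpa using hj)).symm⟩

/-- For a real matrix, the resonance `λ_k - (2 λ_k + conj λ_k)` makes the spectral gap at least half
of the resonance parameter. -/
theorem re_eigenvalue_le (hW : IsUnit W.det)
    (hF₁ : F₁.map (fun r : ℝ => (r : ℂ)) = W * Matrix.diagonal lam * W⁻¹)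
    (hre : ∀ k, (lam k).re ≤ 0) (k : Fin n) :
    (lam k).re ≤ -(resonanceParam lam / 2) := by
  obtain ⟨j, hj⟩ := exists_eq_conj_eigenvalue hW hF₁ k
  have h : resonanceParam lam ≤ 2 * -(lam k).re := by
    -- For a real eigenvalue `j` may equal `k`; writing the multi-index as a sum of indicators
    -- covers this case, and its total is 3 either way.
    refine csInf_le ⟨0, ?_⟩ ⟨k, fun i => 2 * (if i = k then 1 else 0) + (if i = j then 1 else 0),
      ?_, ?_⟩
    · rintro _ ⟨_, _, _, rfl⟩
      exact norm_nonneg _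
    · simp [Finset.sum_add_distrib]
    · have h1 : lam k - ∑ i, ((2 * (if i = k then 1 else 0) + (if i = j then 1 else 0) : ℕ) : ℂ) *
          lam i = ((2 * -(lam k).re : ℝ) : ℂ) := by
        simp only [Nat.cast_add, Nat.cast_mul, Nat.cast_ite, Nat.cast_one, Nat.cast_zero, add_mul,
          Finset.sum_add_distrib, mul_assoc, ← Finset.mul_sum, ite_mul, one_mul, zero_mul,
          Finset.sum_ite_eq', Finset.mem_univ, if_true, hj]
        apply Complex.ext
        · simp
        · simp
          ring
      rw [h1, Complex.norm_real, Real.norm_of_nonneg (by linarith [hre k])]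
  linarith

/-- Variation of constants: an inhomogeneous linear equation with spectral gap `γ`. -/
theorem vecNorm1_le_of_hasDerivWithinAt (hW : IsUnit W.det)
    (hF₁ : F₁.map (fun r : ℝ => (r : ℂ)) = W * Matrix.diagonal lam * W⁻¹)
    {γ : ℝ} (hγ : 0 < γ) (hre : ∀ k, (lam k).re ≤ -γ) {T : ℝ} {v g : ℝ → Fin n → ℝ} {G : ℝ}
    (hv : ∀ t ∈ Set.Icc 0 T, HasDerivWithinAt v (F₁.mulVec (v t) + g t) (Set.Icc 0 T) t)
    (hg : ∀ t ∈ Set.Icc 0 T, vecNorm1 (g t) ≤ G) {t : ℝ} (ht : t ∈ Set.Icc 0 T) :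
    vecNorm1 (v t) ≤ condNum1 W * vecNorm1 (v 0) +
      condNum1 W * G * ((1 - Real.exp (-(γ * t))) / γ) := by
  -- `E τ` is the propagator `exp(τ F₁)`, written in the eigenbasis so that its norm is visibly at
  -- most `κ₁(W) exp(-γ τ)`.
  let E : ℝ → (Fin n → ℝ) → Fin n → ℂ := fun τ u => W.mulVec fun k =>
    Complex.exp (lam k * (τ : ℂ)) * W⁻¹.mulVec (fun i => (u i : ℂ)) k
  have hE : ∀ τ, 0 ≤ τ → ∀ u, vecNorm1 (E τ u) ≤ condNum1 W * vecNorm1 u * Real.exp (-(γ * τ)) := by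
    intro τ hτ u
    refine (vecNorm1_mulVec_le _ _).trans ?_
    rw [condNum1, mul_assoc, mul_assoc]
    refine mul_le_mul_of_nonneg_left ?_ (matNorm1_nonneg _)
    calc _ ≤ Real.exp (-(γ * τ)) * vecNorm1 (W⁻¹.mulVec (fun i => (u i : ℂ))) := by
          unfold vecNorm1
          rw [Finset.mul_sum]
          refine Finset.sum_le_sum fun k _ => ?_
          rw [norm_mul, Complex.norm_exp]
          refine mul_le_mul_of_nonneg_right (Real.exp_le_exp.2 ?_) (norm_nonneg _)
          simp only [Complex.mul_re, Complex.ofReal_re, Complex.ofReal_im, mul_zero, sub_zero]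
          nlinarith [hre k]
      _ ≤ Real.exp (-(γ * τ)) * (matNorm1 W⁻¹ * vecNorm1 u) := by
          rw [← vecNorm1_ofReal u]
          exact mul_le_mul_of_nonneg_left (vecNorm1_mulVec_le _ _) (Real.exp_pos _).le
      _ = _ := by ring
  have hE0 : E 0 (v t) = fun i => (v t i : ℂ) := by
    simp only [E, Complex.ofReal_zero, mul_zero, Complex.exp_zero, one_mul]
    change W.mulVec (W⁻¹.mulVec _) = _
    rw [Matrix.mulVec_mulVec, Matrix.mul_nonsing_inv _ hW, Matrix.one_mulVec]
  have hz : ∀ s ∈ Set.Icc 0 T, ∀ k, HasDerivWithinAt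
      (fun s => W⁻¹.mulVec (fun i => (v s i : ℂ)) k)
      (lam k * W⁻¹.mulVec (fun i => (v s i : ℂ)) k + W⁻¹.mulVec (fun i => (g s i : ℂ)) k)
      (Set.Icc 0 T) s := by
    intro s hs k
    have h1 : HasDerivWithinAt (fun s => W⁻¹.mulVec (fun i => (v s i : ℂ)) k)
        (∑ i, W⁻¹ k i * (((F₁.mulVec (v s) + g s) i : ℝ) : ℂ)) (Set.Icc 0 T) s := by
      simp only [Matrix.mulVec, dotProduct]
      exact HasDerivWithinAt.fun_sum fun i _ =>
        ((hasDerivWithinAt_pi.1 (hv s hs) i).ofReal_comp).const_mul _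
    convert h1 using 1
    have h2 : (fun i => (((F₁.mulVec (v s) + g s) i : ℝ) : ℂ)) =
        (W * Matrix.diagonal lam * W⁻¹).mulVec (fun i => (v s i : ℂ)) + fun i => (g s i : ℂ) := by
      rw [← hF₁]
      ext i
      simp [Matrix.mulVec, dotProduct]
    change _ = W⁻¹.mulVec (fun i => (((F₁.mulVec (v s) + g s) i : ℝ) : ℂ)) k
    rw [h2, Matrix.mulVec_add, Matrix.mulVec_mulVec, ← Matrix.mul_assoc, ← Matrix.mul_assoc,
      Matrix.nonsing_inv_mul _ hW, Matrix.one_mul, ← Matrix.mulVec_mulVec, Pi.add_apply,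
      Matrix.mulVec_diagonal]
  -- In `s ↦ E (t - s) (v s)` the `F₁` terms cancel and only the forcing is left. `WithLp.toLp 1`
  -- makes the ambient norm the `ℓ¹` norm rather than the sup norm.
  have hd : ∀ s ∈ Set.Icc 0 T, HasDerivWithinAt (fun s => WithLp.toLp 1 (E (t - s) (v s)))
      (WithLp.toLp 1 (E (t - s) (g s))) (Set.Icc 0 T) s := by
    intro s hs
    suffices h : HasDerivWithinAt (fun s => E (t - s) (v s)) (E (t - s) (g s)) (Set.Icc 0 T) s from
      (PiLp.hasFDerivAt_toLp (𝕜 := ℝ) 1 (E (t - s) (v s))).comp_hasDerivWithinAt s h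
    refine hasDerivWithinAt_pi.2 fun i => ?_
    change HasDerivWithinAt (fun s : ℝ => ∑ k, W i k * (Complex.exp (lam k * ((t - s : ℝ) : ℂ)) *
        W⁻¹.mulVec (fun i => (v s i : ℂ)) k))
      (∑ k, W i k * (Complex.exp (lam k * ((t - s : ℝ) : ℂ)) *
        W⁻¹.mulVec (fun i => (g s i : ℂ)) k)) (Set.Icc 0 T) s
    refine HasDerivWithinAt.fun_sum fun k _ => ?_
    have h1 : HasDerivWithinAt (fun s : ℝ => Complex.exp (lam k * ((t - s : ℝ) : ℂ)))
        (Complex.exp (lam k * ((t - s : ℝ) : ℂ)) * (lam k * ((-1 : ℝ) : ℂ))) (Set.Icc 0 T) s :=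
      ((((hasDerivWithinAt_id s _).const_sub t).ofReal_comp).const_mul (lam k)).cexp
    refine ((h1.fun_mul (hz s hs k)).const_mul (W i k)).congr_deriv ?_
    push_cast
    ring
  have hnorm : ∀ u : Fin n → ℂ, ‖(WithLp.toLp 1 u : PiLp 1 fun _ : Fin n => ℂ)‖ = vecNorm1 u :=
    fun u => PiLp.norm_eq_of_L1 _
  have hsub : Set.Icc 0 t ⊆ Set.Icc 0 T := Set.Icc_subset_Icc_right ht.2
  -- The curve runs from `E t (v 0)` at `s = 0` to `v t` at `s = t`; the majorant `B` is the
  -- integral of the bound `B'` on the forcing.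
  have key := image_norm_le_of_norm_deriv_right_le_deriv_boundary
    (f := fun s => (WithLp.toLp 1 (E (t - s) (v s)) : PiLp 1 fun _ : Fin n => ℂ))
    (f' := fun s => WithLp.toLp 1 (E (t - s) (g s))) (a := 0) (b := t)
    (B := fun s => condNum1 W * vecNorm1 (v 0) +
      condNum1 W * G * ((Real.exp (-(γ * (t - s))) - Real.exp (-(γ * t))) / γ))
    (B' := fun s => condNum1 W * G * Real.exp (-(γ * (t - s))))
    (fun s hs => ((hd s (hsub hs)).continuousWithinAt).mono hsub)
    (fun s hs => by
      have hs' : s ∈ Set.Ico 0 T := ⟨hs.1, hs.2.trans_le ht.2⟩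
      exact ((hd s (Set.Ico_subset_Icc_self hs')).mono_of_mem_nhdsWithin
        (Icc_mem_nhdsGE_of_mem hs')))
    (by
      rw [hnorm]
      refine (hE (t - 0) (by linarith [ht.1]) _).trans ?_
      simp only [sub_zero, sub_self, zero_div, mul_zero, add_zero]
      refine mul_le_of_le_one_right (mul_nonneg (condNum1_nonneg W) (vecNorm1_nonneg _)) ?_
      rw [Real.exp_le_one_iff]
      nlinarith [ht.1])
    (fun s => by
      have h1 : HasDerivAt (fun s : ℝ => -(γ * (t - s))) γ s := by
        simpa using (((hasDerivAt_id s).const_sub t).const_mul γ).fun_neg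
      have h2 := (((h1.exp.sub_const (Real.exp (-(γ * t)))).div_const γ).const_mul
        (condNum1 W * G)).const_add (condNum1 W * vecNorm1 (v 0))
      rwa [mul_div_cancel_right₀ _ hγ.ne'] at h2)
    (fun s hs => by
      rw [hnorm]
      have hs' := hsub (Set.Ico_subset_Icc_self hs)
      refine (hE (t - s) (by linarith [hs.2]) _).trans ?_
      exact mul_le_mul_of_nonneg_right (mul_le_mul_of_nonneg_left (hg s hs') (condNum1_nonneg W))
        (Real.exp_pos _).le)
    (Set.right_mem_Icc.2 ht.1)
  simpa only [hnorm, sub_self, hE0, vecNorm1_ofReal, mul_zero, neg_zero, Real.exp_zero] using key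

/-- The time-uniform form, from `1 - exp(-γt) ≤ 1`; it closes the recursions without further powers
of `T`. -/
theorem vecNorm1_le_div_of_hasDerivWithinAt (hW : IsUnit W.det)
    (hF₁ : F₁.map (fun r : ℝ => (r : ℂ)) = W * Matrix.diagonal lam * W⁻¹)
    {γ : ℝ} (hγ : 0 < γ) (hre : ∀ k, (lam k).re ≤ -γ) {T : ℝ} {v g : ℝ → Fin n → ℝ} {G : ℝ}
    (hv : ∀ t ∈ Set.Icc 0 T, HasDerivWithinAt v (F₁.mulVec (v t) + g t) (Set.Icc 0 T) t)
    (hg : ∀ t ∈ Set.Icc 0 T, vecNorm1 (g t) ≤ G) (hv0 : v 0 = 0) {t : ℝ}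
    (ht : t ∈ Set.Icc 0 T) : vecNorm1 (v t) ≤ condNum1 W * G / γ := by
  have h := vecNorm1_le_of_hasDerivWithinAt hW hF₁ hγ hre hv hg ht
  have hG : 0 ≤ G := (vecNorm1_nonneg _).trans (hg t ht)
  rw [hv0, vecNorm1_zero, mul_zero, zero_add] at h
  refine h.trans ?_
  rw [mul_div_assoc' (condNum1 W * G)]
  refine div_le_div_of_nonneg_right ?_ hγ.le
  exact mul_le_of_le_one_right (mul_nonneg (condNum1_nonneg W) hG)
    (by linarith [Real.exp_pos (-(γ * t))])

/-- The form linear in `T`, from `1 - exp(-γt) ≤ γt`; it is what puts the factor `T` into the first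
remainder. -/
theorem vecNorm1_le_mul_of_hasDerivWithinAt (hW : IsUnit W.det)
    (hF₁ : F₁.map (fun r : ℝ => (r : ℂ)) = W * Matrix.diagonal lam * W⁻¹)
    {γ : ℝ} (hγ : 0 < γ) (hre : ∀ k, (lam k).re ≤ -γ) {T : ℝ} {v g : ℝ → Fin n → ℝ} {G : ℝ}
    (hv : ∀ t ∈ Set.Icc 0 T, HasDerivWithinAt v (F₁.mulVec (v t) + g t) (Set.Icc 0 T) t)
    (hg : ∀ t ∈ Set.Icc 0 T, vecNorm1 (g t) ≤ G) (hv0 : v 0 = 0) {t : ℝ}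
    (ht : t ∈ Set.Icc 0 T) : vecNorm1 (v t) ≤ condNum1 W * G * T := by
  have h := vecNorm1_le_of_hasDerivWithinAt hW hF₁ hγ hre hv hg ht
  have hG : 0 ≤ G := (vecNorm1_nonneg _).trans (hg t ht)
  rw [hv0, vecNorm1_zero, mul_zero, zero_add] at h
  refine h.trans (mul_le_mul_of_nonneg_left ?_ (mul_nonneg (condNum1_nonneg W) hG))
  rw [div_le_iff₀ hγ]
  nlinarith [Real.add_one_le_exp (-(γ * t)), ht.2]

end Spectrum

/-! ### Carleman blocks acting on pure tensor powers. -/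

section Algebra

variable {n : ℕ} {R : Type*} [CommRing R] [Algebra ℝ R]

/-- The summand is a product over the tensor slots, so the sum over `b` factors: slot `i` carries
`f`, and every other slot collapses to the identity. -/
theorem sum_smul_prod_one_eq {j : ℕ} (f : Fin n → ℝ) (a : Fin j → Fin n) (i : Fin j)
    (U : Fin n → R) :
    ∑ b : Fin j → Fin n, (f (b i) *
        ∏ k, if k = i then 1 else (1 : Matrix (Fin n) (Fin n) ℝ) (a k) (b k)) • ∏ k, U (b k) =
      (∑ c, f c • U c) * ∏ k ∈ Finset.univ.erase i, U (a k) := by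
  let φ : Fin j → Fin n → R := fun k c =>
    if k = i then f c • U c else (1 : Matrix (Fin n) (Fin n) ℝ) (a k) c • U c
  have h1 : ∀ b : Fin j → Fin n, (f (b i) *
        ∏ k, if k = i then 1 else (1 : Matrix (Fin n) (Fin n) ℝ) (a k) (b k)) • ∏ k, U (b k) =
      ∏ k, φ k (b k) := by
    intro b
    rw [← Finset.mul_prod_erase _ _ (Finset.mem_univ i),
      ← Finset.mul_prod_erase _ (fun k => U (b k)) (Finset.mem_univ i),
      ← Finset.mul_prod_erase _ (fun k => φ k (b k)) (Finset.mem_univ i), if_pos rfl, one_mul,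
      ← smul_mul_smul_comm, ← Finset.prod_smul]
    refine congr_arg₂ _ (by simp [φ]) (Finset.prod_congr rfl fun k hk => ?_)
    simp only [φ, if_neg (Finset.ne_of_mem_erase hk)]
  rw [Finset.sum_congr rfl fun b _ => h1 b]
  have h2 := Finset.prod_univ_sum (fun _ : Fin j => (Finset.univ : Finset (Fin n))) φ
  rw [Fintype.piFinset_univ] at h2
  rw [← h2, ← Finset.mul_prod_erase _ _ (Finset.mem_univ i)]
  refine congr_arg₂ _ (by simp [φ]) (Finset.prod_congr rfl fun k hk => ?_)
  simp only [φ, if_neg (Finset.ne_of_mem_erase hk), Matrix.one_apply, ite_smul, one_smul, zero_smul,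
    Finset.sum_ite_eq, Finset.mem_univ, if_true]

theorem sum_smul_mul_prod_one_eq {j : ℕ} (f : Fin n → ℝ) (a : Fin j → Fin n) (i : Fin j)
    (U : Fin n → R) (r : R) :
    ∑ b : Fin j → Fin n, (f (b i) *
        ∏ k, if k = i then 1 else (1 : Matrix (Fin n) (Fin n) ℝ) (a k) (b k)) •
          (r * ∏ k, U (b k)) =
      (∑ c, f c • (r * U c)) * ∏ k ∈ Finset.univ.erase i, U (a k) := by
  refine (Finset.sum_congr rfl fun b _ => (mul_smul_comm _ _ _).symm).trans ?_
  rw [← Finset.mul_sum, sum_smul_prod_one_eq, ← mul_assoc, Finset.mul_sum]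
  simp only [mul_smul_comm]

theorem sum_diagBlock_smul_prod (F₁ : Matrix (Fin n) (Fin n) ℝ) {j : ℕ} (a : Fin j → Fin n)
    (U : Fin n → R) :
    ∑ b, diagBlock F₁ j a b • ∏ k, U (b k) =
      ∑ i, (∑ c, F₁ (a i) c • U c) * ∏ k ∈ Finset.univ.erase i, U (a k) := by
  simp only [diagBlock, Finset.sum_smul]
  rw [Finset.sum_comm]
  exact Finset.sum_congr rfl fun i _ => sum_smul_prod_one_eq (F₁ (a i)) a i U

theorem sum_superBlock_smul_prod (F₂ : Matrix (Fin n) (Fin n × Fin n) ℝ) {j : ℕ}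
    (a : Fin j → Fin n) (U : Fin n → R) :
    ∑ b, superBlock F₂ j a b • ∏ k, U (b k) =
      ∑ i, (∑ p, F₂ (a i) p • (U p.1 * U p.2)) * ∏ k ∈ Finset.univ.erase i, U (a k) := by
  simp only [superBlock, Finset.sum_smul]
  rw [Finset.sum_comm]
  refine Finset.sum_congr rfl fun i _ => ?_
  -- Split off slot `i` of the `j + 1` slots as `c`. The remaining slots form a multi-index of
  -- length `j` whose slot `i` is the old slot `i + 1`, which reduces the sum to the one-slot case.
  rw [← (Fin.insertNthEquiv (fun _ => Fin n) i.castSucc).sum_comp, Fintype.sum_prod_type,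
    Fintype.sum_prod_type, Finset.sum_mul]
  refine Finset.sum_congr rfl fun c _ => ?_
  refine Eq.trans (Finset.sum_congr rfl fun b _ => ?_)
    (sum_smul_mul_prod_one_eq (fun d => F₂ (a i) (c, d)) a i U (U c))
  · have hs : ∀ k : Fin j, k ≠ i → (Fin.insertNthEquiv (fun _ => Fin n) i.castSucc) (c, b)
        (if k < i then k.castSucc else k.succ) = b k := by
      intro k hk
      have h2 : (if k < i then k.castSucc else k.succ) = i.castSucc.succAbove k := by
        simp [Fin.succAbove]
      rw [h2]
      simp [Fin.insertNthEquiv]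
    have h0 : (Fin.insertNthEquiv (fun _ => Fin n) i.castSucc) (c, b) i.castSucc = c := by
      simp [Fin.insertNthEquiv]
    have h1 : (Fin.insertNthEquiv (fun _ => Fin n) i.castSucc) (c, b) i.succ = b i := by
      have h2 : (Fin.insertNthEquiv (fun _ => Fin n) i.castSucc) (c, b)
          (i.castSucc.succAbove i) = b i := Fin.insertNth_apply_succAbove (α := fun _ => Fin n) ..
      rwa [Fin.succAbove_castSucc_self] at h2
    rw [h0, h1, Fin.prod_univ_succAbove _ i.castSucc, h0]
    refine congr_arg₂ _ (congr_arg₂ _ rfl ?_) (congr_arg₂ _ rfl ?_)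
    · refine Finset.prod_congr rfl fun k _ => ?_
      rcases lt_trichotomy k i with hk | hk | hk
      · have := hs k hk.ne
        rw [if_pos hk] at this
        rw [if_pos hk, if_neg hk.ne, this]
      · simp [hk]
      · have := hs k hk.ne'
        rw [if_neg hk.not_gt] at this
        rw [if_neg hk.not_gt, if_pos hk, if_neg hk.ne', this]
    · refine Finset.prod_congr rfl fun k _ => ?_
      simp [Fin.insertNthEquiv]

end Algebra

/-! ### Coefficientwise differentiation of power series. -/

section CoeffDeriv

open PowerSeries

/-- The coefficients up to degree `N` of a curve of power series are differentiable at `t`. -/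
def HasCoeffDerivAt (N : ℕ) (f : ℝ → PowerSeries ℝ) (f' : PowerSeries ℝ) (t : ℝ) : Prop :=
  ∀ m ≤ N, HasDerivAt (fun s => coeff m (f s)) (coeff m f') t

variable {N : ℕ} {t : ℝ}

theorem HasCoeffDerivAt.mul {f g : ℝ → PowerSeries ℝ} {f' g' : PowerSeries ℝ}
    (hf : HasCoeffDerivAt N f f' t) (hg : HasCoeffDerivAt N g g' t) :
    HasCoeffDerivAt N (fun s => f s * g s) (f' * g t + f t * g') t := by
  intro m hm
  simp only [map_add, coeff_mul, ← Finset.sum_add_distrib]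
  refine HasDerivAt.fun_sum fun q hq => ?_
  have h := Finset.HasAntidiagonal.mem_antidiagonal.1 hq
  exact (hf q.1 (by omega)).fun_mul (hg q.2 (by omega))

theorem HasCoeffDerivAt.finset_prod {ι : Type*} [DecidableEq ι] {f : ι → ℝ → PowerSeries ℝ}
    {f' : ι → PowerSeries ℝ} (s : Finset ι) (h : ∀ i ∈ s, HasCoeffDerivAt N (f i) (f' i) t) :
    HasCoeffDerivAt N (fun τ => ∏ i ∈ s, f i τ)
      (∑ i ∈ s, f' i * ∏ k ∈ s.erase i, f k t) t := by
  induction s using Finset.induction_on with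
  | empty =>
    intro m _
    simpa using hasDerivAt_const t (coeff m (1 : PowerSeries ℝ))
  | insert a s ha ih =>
    have h1 := (h a (Finset.mem_insert_self a s)).mul
      (ih fun i hi => h i (Finset.mem_insert_of_mem hi))
    simp only [Finset.prod_insert ha]
    convert h1 using 1
    rw [Finset.sum_insert ha, Finset.erase_insert ha, Finset.mul_sum]
    refine congr_arg₂ _ rfl (Finset.sum_congr rfl fun i hi => ?_)
    have hne : a ≠ i := fun e => ha (e ▸ hi)
    rw [Finset.erase_insert_of_ne hne, Finset.prod_insert fun e => ha (Finset.mem_of_mem_erase e)]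
    ring

end CoeffDeriv

/-! ### Existence and uniqueness for linear equations. -/

section LinearODE

theorem exists_forall_hasDerivAt_linear {E : Type*} [NormedAddCommGroup E] [NormedSpace ℝ E]
    [CompleteSpace E] (A : E →L[ℝ] E) {g : ℝ → E} (hg : Continuous g) (x₀ : E) :
    ∃ v : ℝ → E, v 0 = x₀ ∧ ∀ t, HasDerivAt v (A (v t) + g t) t := by
  have hexp : ∀ t : ℝ, HasDerivAt (fun s : ℝ => NormedSpace.exp (s • A))
      (A * NormedSpace.exp (t • A)) t := fun t => hasDerivAt_exp_smul_const' A t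
  have hcont : Continuous fun s : ℝ => NormedSpace.exp (s • A) :=
    continuous_iff_continuousAt.2 fun t => (hexp t).continuousAt
  have hint : Continuous fun s : ℝ => NormedSpace.exp ((-s) • A) (g s) :=
    (hcont.comp continuous_neg).clm_apply hg
  refine ⟨fun t => NormedSpace.exp (t • A) (x₀ + ∫ s in (0 : ℝ)..t,
    NormedSpace.exp ((-s) • A) (g s)), by simp, fun t => ?_⟩
  have h := (hexp t).clm_apply ((hint.integral_hasStrictDerivAt 0 t).hasDerivAt.const_add x₀)
  refine h.congr_deriv (congr_arg₂ _ rfl ?_)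
  have hinv : NormedSpace.exp (t • A) * NormedSpace.exp ((-t) • A) = 1 := by
    let _ : NormedAlgebra ℚ (E →L[ℝ] E) := .restrictScalars ℚ ℝ _
    rw [← NormedSpace.exp_add_of_commute, ← add_smul]
    · simp
    · exact ((Commute.refl A).smul_left _).smul_right _
  calc _ = (NormedSpace.exp (t • A) * NormedSpace.exp ((-t) • A)) (g t) := rfl
    _ = g t := by rw [hinv]; rfl

theorem eq_zero_of_hasDerivWithinAt_mulVec {ι : Type*} [Fintype ι] (A : Matrix ι ι ℝ) {T : ℝ}
    {v : ℝ → ι → ℝ} (hv0 : v 0 = 0)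
    (hv : ∀ t ∈ Set.Icc 0 T, HasDerivWithinAt v (A.mulVec (v t)) (Set.Icc 0 T) t) :
    ∀ t ∈ Set.Icc 0 T, v t = 0 := by
  let L : (ι → ℝ) →L[ℝ] (ι → ℝ) := LinearMap.toContinuousLinearMap A.mulVecLin
  refine eq_zero_of_abs_deriv_le_mul_abs_self_of_eq_zero_right (f' := fun t => A.mulVec (v t))
    (K := ‖L‖) (fun t ht => (hv t ht).continuousWithinAt) (fun t ht => ?_) hv0
    fun t _ => L.le_opNorm (v t)
  exact (hv t (Set.Ico_subset_Icc_self ht)).mono_of_mem_nhdsWithin (Icc_mem_nhdsGE_of_mem ht)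

end LinearODE

/-! ### The formal solution, and its identification with the truncated Carleman solution. -/

section TaylorFlow

variable {n : ℕ}

/-- The degree-`m` part of `u ⊗ u` for a graded family `u`. -/
def homTensor (u : ℕ → ℝ → Fin n → ℝ) (m : ℕ) (t : ℝ) : Fin n × Fin n → ℝ :=
  fun p => ∑ q ∈ Finset.HasAntidiagonal.antidiagonal m, u q.1 t p.1 * u q.2 t p.2

/-- `u m` is, for `m ≤ N`, the part of degree `m` in the initial value of the formal solution of
`x' = F₁ x + F₂ (x ⊗ x)`, `x 0 = xin`. -/
structure IsTaylorFlow (F₁ : Matrix (Fin n) (Fin n) ℝ) (F₂ : Matrix (Fin n) (Fin n × Fin n) ℝ)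
    (xin : Fin n → ℝ) (N : ℕ) (u : ℕ → ℝ → Fin n → ℝ) : Prop where
  zero : u 0 = 0
  init_one : u 1 0 = xin
  init : ∀ m, 2 ≤ m → m ≤ N → u m 0 = 0
  deriv : ∀ m ≤ N, ∀ t, HasDerivAt (u m) (F₁.mulVec (u m t) + F₂.mulVec (homTensor u m t)) t

variable {F₁ : Matrix (Fin n) (Fin n) ℝ} {F₂ : Matrix (Fin n) (Fin n × Fin n) ℝ}
  {xin : Fin n → ℝ} {N : ℕ} {u : ℕ → ℝ → Fin n → ℝ}

/-- Because `u 0 = 0`, degree `m` of `u ⊗ u` involves only degrees below `m`. The hierarchy is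
therefore triangular and can be solved one degree at a time. -/
theorem homTensor_congr {u v : ℕ → ℝ → Fin n → ℝ} {m : ℕ} (hu : u 0 = 0) (hv : v 0 = 0)
    (h : ∀ k < m, u k = v k) : homTensor u m = homTensor v m := by
  funext t p
  refine Finset.sum_congr rfl fun q hq => ?_
  have hq' := Finset.HasAntidiagonal.mem_antidiagonal.1 hq
  rcases Nat.eq_zero_or_pos q.1 with h1 | h1
  · simp [h1, hu, hv]
  rcases Nat.eq_zero_or_pos q.2 with h2 | h2
  · simp [h2, hu, hv]
  rw [h q.1 (by omega), h q.2 (by omega)]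

theorem exists_hasDerivAt_mulVec (A : Matrix (Fin n) (Fin n) ℝ) {g : ℝ → Fin n → ℝ}
    (hg : Continuous g) (x₀ : Fin n → ℝ) :
    ∃ v : ℝ → Fin n → ℝ, v 0 = x₀ ∧ ∀ t, HasDerivAt v (A.mulVec (v t) + g t) t :=
  exists_forall_hasDerivAt_linear (LinearMap.toContinuousLinearMap A.mulVecLin) hg x₀

theorem exists_isTaylorFlow (F₁ : Matrix (Fin n) (Fin n) ℝ)
    (F₂ : Matrix (Fin n) (Fin n × Fin n) ℝ) (xin : Fin n → ℝ) (N : ℕ) (hN : 1 ≤ N) :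
    ∃ u, IsTaylorFlow F₁ F₂ xin N u := by
  induction N, hN using Nat.le_induction with
  | base =>
    obtain ⟨v, hv0, hv⟩ := exists_hasDerivAt_mulVec F₁ (g := fun _ => 0) continuous_const xin
    refine ⟨Function.update 0 1 v, by simp, by simpa using hv0, fun m h1 h2 => by omega,
      fun m hm t => ?_⟩
    have h0 : homTensor (Function.update 0 1 v) m = homTensor (0 : ℕ → ℝ → Fin n → ℝ) m :=
      homTensor_congr (by simp) rfl fun k hk => by rw [Function.update_of_ne (by omega)]
    have h1 : homTensor (0 : ℕ → ℝ → Fin n → ℝ) m t = 0 := by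
      funext p
      simp [homTensor]
    rw [h0, h1, Matrix.mulVec_zero]
    interval_cases m
    · simp [hasDerivAt_zero]
    · simpa using hv t
  | succ N hN ih =>
    obtain ⟨u, hu⟩ := ih
    have hc : ∀ m ≤ N, Continuous (u m) := fun m hm =>
      continuous_iff_continuousAt.2 fun t => (hu.deriv m hm t).continuousAt
    -- Nothing is known about `u m` beyond degree `N`; replacing those terms by zero makes the
    -- forcing continuous and, by `homTensor_congr`, does not change it.
    let w : ℕ → ℝ → Fin n → ℝ := fun m => if m ≤ N then u m else 0
    have hw0 : w 0 = 0 := by simp [w, hu.zero]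
    have hwc : ∀ m, Continuous (w m) := by
      intro m
      by_cases hm : m ≤ N
      · simpa [w, hm] using hc m hm
      · simpa [w, hm] using continuous_zero
    have hg : Continuous fun t => F₂.mulVec (homTensor w (N + 1) t) := by
      refine (LinearMap.toContinuousLinearMap F₂.mulVecLin).continuous.comp ?_
      refine continuous_pi fun p => continuous_finsetSum _ fun q _ => ?_
      exact ((continuous_apply p.1).comp (hwc q.1)).mul ((continuous_apply p.2).comp (hwc q.2))
    obtain ⟨v, hv0, hv⟩ := exists_hasDerivAt_mulVec F₁ hg 0
    have hlt : ∀ k < N + 1, Function.update u (N + 1) v k = u k := fun k hk =>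
      Function.update_of_ne hk.ne _ _
    have hz : Function.update u (N + 1) v 0 = 0 := by rw [hlt 0 (by omega), hu.zero]
    refine ⟨Function.update u (N + 1) v, hz, ?_, fun m h1 h2 => ?_, fun m hm t => ?_⟩
    · rw [hlt 1 (by omega), hu.init_one]
    · rcases Nat.lt_or_ge m (N + 1) with h | h
      · rw [hlt m h, hu.init m h1 (by omega)]
      · obtain rfl : m = N + 1 := by omega
        simpa using hv0
    · rcases Nat.lt_or_ge m (N + 1) with h | h
      · rw [hlt m h, homTensor_congr hz hu.zero fun k hk => hlt k (by omega)]
        exact hu.deriv m (by omega) t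
      · obtain rfl : m = N + 1 := by omega
        rw [homTensor_congr hz hw0 fun k hk => by
          rw [hlt k hk]
          simp [w, Nat.lt_succ_iff.1 hk]]
        simpa using hv t

open PowerSeries

/-- The formal solution as a vector of power series in the size of the initial value. -/
noncomputable def flowSeries (u : ℕ → ℝ → Fin n → ℝ) (t : ℝ) (i : Fin n) : PowerSeries ℝ :=
  PowerSeries.mk fun m => u m t i

/-- The sum of the coefficients up to degree `N`. -/
noncomputable def partialSum (N : ℕ) : PowerSeries ℝ →ₗ[ℝ] ℝ :=
  ∑ m ∈ Finset.range (N + 1), PowerSeries.coeff m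

/-- The solution of the level-`N` Carleman system: the tensor powers of the formal solution,
truncated at degree `N`. -/
noncomputable def carlemanFlow (N : ℕ) (u : ℕ → ℝ → Fin n → ℝ) (j : ℕ) (t : ℝ) : (Fin j → Fin n) → ℝ :=
  fun a => partialSum N (∏ k, flowSeries u t (a k))

theorem partialSum_apply (N : ℕ) (f : PowerSeries ℝ) :
    partialSum N f = ∑ m ∈ Finset.range (N + 1), PowerSeries.coeff m f := by
  simp [partialSum]

theorem HasCoeffDerivAt.partialSum {f : ℝ → PowerSeries ℝ} {f' : PowerSeries ℝ} {t : ℝ}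
    (h : HasCoeffDerivAt N f f' t) :
    HasDerivAt (fun s => partialSum N (f s)) (partialSum N f') t := by
  simp only [partialSum_apply]
  exact HasDerivAt.fun_sum fun m hm => h m (Nat.lt_succ_iff.1 (Finset.mem_range.1 hm))

theorem IsTaylorFlow.hasCoeffDerivAt (hu : IsTaylorFlow F₁ F₂ xin N u) (t : ℝ) (i : Fin n) :
    HasCoeffDerivAt N (fun s => flowSeries u s i)
      (∑ c, F₁ i c • flowSeries u t c +
        ∑ p, F₂ i p • (flowSeries u t p.1 * flowSeries u t p.2)) t := by
  intro m hm
  have h := hasDerivAt_pi.1 (hu.deriv m hm t) i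
  have e : (fun s => coeff m (flowSeries u s i)) = fun s => u m s i :=
    funext fun s => coeff_mk _ _
  rw [e, map_add, map_sum, map_sum]
  refine h.congr_deriv ?_
  rw [Pi.add_apply, Matrix.mulVec, Matrix.mulVec, dotProduct, dotProduct]
  refine (congr_arg₂ (· + ·) (Finset.sum_congr rfl fun c _ => ?_)
    (Finset.sum_congr rfl fun p _ => ?_))
  · rw [map_smul, flowSeries, coeff_mk, smul_eq_mul]
  · rw [map_smul, coeff_mul, smul_eq_mul]
    simp only [flowSeries, coeff_mk]
    rfl

/-- The product rule for tensor powers of a solution is the Carleman system itself, and it survives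
truncation because the blocks act linearly on each coefficient. -/
theorem carlemanFlow_hasDerivAt (hu : IsTaylorFlow F₁ F₂ xin N u) (j : ℕ) (t : ℝ) :
    HasDerivAt (carlemanFlow N u j) ((diagBlock F₁ j).mulVec (carlemanFlow N u j t) +
      (superBlock F₂ j).mulVec (carlemanFlow N u (j + 1) t)) t := by
  refine hasDerivAt_pi.2 fun a => ?_
  have h := (HasCoeffDerivAt.finset_prod Finset.univ
    fun (k : Fin j) _ => hu.hasCoeffDerivAt t (a k)).partialSum
  refine h.congr_deriv ?_
  simp only [add_mul, Finset.sum_add_distrib]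
  rw [← sum_diagBlock_smul_prod, ← sum_superBlock_smul_prod, map_add, map_sum, map_sum]
  simp only [map_smul, smul_eq_mul]
  rfl

theorem X_pow_dvd_prod_flowSeries (hu : u 0 = 0) {j : ℕ} (t : ℝ) (a : Fin j → Fin n) :
    (X : PowerSeries ℝ) ^ j ∣ ∏ k, flowSeries u t (a k) := by
  have h : ∀ i, (X : PowerSeries ℝ) ∣ flowSeries u t i := fun i => by
    simp [X_dvd_iff, flowSeries, hu]
  simpa using Finset.prod_dvd_prod_of_dvd (fun _ => (X : PowerSeries ℝ))
    (fun k => flowSeries u t (a k)) (s := Finset.univ) fun k _ => h (a k)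

/-- A product of `N + 1` series without constant term starts in degree `N + 1`. This is what closes
the system at level `N`. -/
theorem carlemanFlow_succ_eq_zero (hu : u 0 = 0) (t : ℝ) : carlemanFlow N u (N + 1) t = 0 := by
  funext a
  rw [carlemanFlow, partialSum_apply]
  exact Finset.sum_eq_zero fun m hm => X_pow_dvd_iff.1 (X_pow_dvd_prod_flowSeries hu t a) m
    (Finset.mem_range.1 hm)

theorem carlemanFlow_zero (hu : IsTaylorFlow F₁ F₂ xin N u) {j : ℕ} (hjN : j ≤ N) :
    carlemanFlow N u j 0 = tensorPow xin j := by
  funext a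
  have h1 : ∀ m ≤ N, ∀ i, coeff m (flowSeries u 0 i) = coeff m (C (xin i) * X) := by
    intro m hm i
    rw [flowSeries, coeff_mk, coeff_C_mul, coeff_X]
    rcases Nat.lt_trichotomy m 1 with h | rfl | h
    · obtain rfl : m = 0 := by omega
      simp [hu.zero]
    · simp [hu.init_one]
    · rw [hu.init m h hm, if_neg h.ne']
      simp
  have h2 : ∀ (s : Finset (Fin j)), ∀ m ≤ N, coeff m (∏ k ∈ s, flowSeries u 0 (a k)) =
      coeff m (∏ k ∈ s, (C (xin (a k)) * X)) := by
    intro s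
    induction s using Finset.induction_on with
    | empty => simp
    | insert b s hb ih =>
      intro m hm
      rw [Finset.prod_insert hb, Finset.prod_insert hb, coeff_mul, coeff_mul]
      refine Finset.sum_congr rfl fun q hq => ?_
      have hq' := Finset.HasAntidiagonal.mem_antidiagonal.1 hq
      rw [h1 q.1 (by omega), ih q.2 (by omega)]
  rw [carlemanFlow, partialSum_apply, Finset.sum_congr rfl fun m hm =>
    h2 Finset.univ m (Nat.lt_succ_iff.1 (Finset.mem_range.1 hm))]
  simp only [Finset.prod_mul_distrib, ← map_prod, Finset.prod_const, Finset.card_univ,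
    Fintype.card_fin, coeff_C_mul, coeff_X_pow, mul_ite, mul_one, mul_zero, Finset.sum_ite_eq',
    Finset.mem_range, tensorPow]
  rw [if_pos (by omega)]

/-- The truncated Carleman system is solved by the truncated tensor powers of the formal solution,
and only by them. -/
theorem IsCarlemanSolution.eq_carlemanFlow {T : ℝ} {y : (j : ℕ) → ℝ → (Fin j → Fin n) → ℝ}
    (hy : IsCarlemanSolution F₁ F₂ xin N T y) (hu : IsTaylorFlow F₁ F₂ xin N u) {j : ℕ}
    (hj : 1 ≤ j) (hjN : j ≤ N) : ∀ t ∈ Set.Icc 0 T, y j t = carlemanFlow N u j t := by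
  -- Block `j` is driven by block `j + 1`, so uniqueness descends from the closed equation of block
  -- `N`.
  induction hjN using Nat.decreasingInduction with
  | self =>
    obtain ⟨h0, hd⟩ := hy N hj le_rfl
    have := eq_zero_of_hasDerivWithinAt_mulVec (diagBlock F₁ N)
      (v := fun t => y N t - carlemanFlow N u N t) (T := T)
      (by rw [h0, carlemanFlow_zero hu le_rfl, sub_self]) fun t ht => by
        refine ((hd t ht).sub (carlemanFlow_hasDerivAt hu N t).hasDerivWithinAt).congr_deriv ?_
        rw [if_neg (lt_irrefl N), carlemanFlow_succ_eq_zero hu.zero, Matrix.mulVec_zero, add_zero,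
          add_zero, Matrix.mulVec_sub]
    exact fun t ht => sub_eq_zero.1 (this t ht)
  | of_succ k hk ih =>
    obtain ⟨h0, hd⟩ := hy k hj hk.le
    have := eq_zero_of_hasDerivWithinAt_mulVec (diagBlock F₁ k)
      (v := fun t => y k t - carlemanFlow N u k t) (T := T)
      (by rw [h0, carlemanFlow_zero hu hk.le, sub_self]) fun t ht => by
        refine ((hd t ht).sub (carlemanFlow_hasDerivAt hu k t).hasDerivWithinAt).congr_deriv ?_
        rw [if_pos hk, ih (by omega) t ht, Matrix.mulVec_sub, add_sub_add_right_eq_sub]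
    exact fun t ht => sub_eq_zero.1 (this t ht)

theorem IsCarlemanSolution.firstBlock_eq {T : ℝ} {y : (j : ℕ) → ℝ → (Fin j → Fin n) → ℝ}
    (hy : IsCarlemanSolution F₁ F₂ xin N T y) (hu : IsTaylorFlow F₁ F₂ xin N u) (hN : 1 ≤ N)
    {t : ℝ} (ht : t ∈ Set.Icc 0 T) :
    firstBlock y t = ∑ m ∈ Finset.range (N + 1), u m t := by
  funext i
  rw [firstBlock, hy.eq_carlemanFlow hu le_rfl hN t ht, carlemanFlow, partialSum_apply,
    Finset.sum_apply]
  simp [flowSeries]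

end TaylorFlow

/-! ### Catalan bounds for the Taylor terms and remainders. -/

section Bounds

theorem catalan_succ_eq_sum_range (k : ℕ) :
    (catalan (k + 1) : ℝ) = ∑ i ∈ Finset.range (k + 1), (catalan i : ℝ) * catalan (k - i) := by
  rw [catalan_succ, Finset.sum_range]
  push_cast
  rfl

/-- The ratio of `catalan (k + 2)` to `catalan (k + 1)` is `2(2k + 3)/(k + 3) ≤ 4`, and `catalan 1 =
1`. -/
theorem catalan_succ_le_four_pow (k : ℕ) : catalan (k + 1) ≤ 4 ^ k := by
  induction k with
  | zero => simp
  | succ k ih =>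
    have h1 := succ_mul_catalan_eq_centralBinom (k + 1)
    have h2 := succ_mul_catalan_eq_centralBinom (k + 2)
    have h3 := Nat.succ_mul_centralBinom_succ (k + 1)
    have h4 : (k + 3) * catalan (k + 2) ≤ (k + 3) * (4 * catalan (k + 1)) := by
      have h5 : (k + 2) * ((k + 3) * catalan (k + 2)) =
          (k + 2) * (2 * (2 * k + 3) * catalan (k + 1)) := by
        calc _ = (k + 2) * (k + 2).centralBinom := by rw [← h2]
          _ = 2 * (2 * (k + 1) + 1) * (k + 1).centralBinom := h3
          _ = _ := by rw [← h1]; ring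
      rw [Nat.eq_of_mul_eq_mul_left (by omega) h5]
      nlinarith
    have := Nat.le_of_mul_le_mul_left h4 (by omega)
    rw [pow_succ]
    exact this.trans (by omega)

variable {n N : ℕ} {F₁ : Matrix (Fin n) (Fin n) ℝ} {F₂ : Matrix (Fin n) (Fin n × Fin n) ℝ}
  {W : Matrix (Fin n) (Fin n) ℂ} {lam : Fin n → ℂ} {xin : Fin n → ℝ} {T γ μ ν : ℝ}
  {x : ℝ → Fin n → ℝ} {u : ℕ → ℝ → Fin n → ℝ}

/-- The remainder of `x` after the terms of degree at most `m`. -/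
def remainder (x : ℝ → Fin n → ℝ) (u : ℕ → ℝ → Fin n → ℝ) (m : ℕ) (t : ℝ) : Fin n → ℝ :=
  x t - ∑ a ∈ Finset.range (m + 1), u a t

theorem remainder_zero (hu : u 0 = 0) (t : ℝ) : remainder x u 0 t = x t := by
  simp [remainder, hu]

theorem remainder_initial (hx : IsQuadraticSolution F₁ F₂ xin T x)
    (hu : IsTaylorFlow F₁ F₂ xin N u) {m : ℕ} (hm : m + 1 ≤ N) : remainder x u (m + 1) 0 = 0 := by
  rw [remainder, Finset.sum_range_succ', Finset.sum_range_succ', Finset.sum_eq_zero, hx.1, hu.zero]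
  · simp [hu.init_one]
  · intro a ha
    have := Finset.mem_range.1 ha
    exact hu.init _ (by omega) (by omega)

theorem remainder_hasDerivWithinAt (hx : IsQuadraticSolution F₁ F₂ xin T x)
    (hu : IsTaylorFlow F₁ F₂ xin N u) {m : ℕ} (hm : m ≤ N) {t : ℝ} (ht : t ∈ Set.Icc 0 T) :
    HasDerivWithinAt (remainder x u m) (F₁.mulVec (remainder x u m t) +
      F₂.mulVec (tensorSq (x t) - ∑ a ∈ Finset.range (m + 1), homTensor u a t))
      (Set.Icc 0 T) t := by
  have h : HasDerivAt (fun t => ∑ a ∈ Finset.range (m + 1), u a t)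
      (∑ a ∈ Finset.range (m + 1), (F₁.mulVec (u a t) + F₂.mulVec (homTensor u a t))) t :=
    HasDerivAt.fun_sum fun a ha =>
      hu.deriv a ((Nat.lt_succ_iff.1 (Finset.mem_range.1 ha)).trans hm) t
  refine ((hx.2 t ht).sub h.hasDerivWithinAt).congr_deriv ?_
  rw [remainder, Matrix.mulVec_sub, Matrix.mulVec_sub, Finset.sum_add_distrib,
    Matrix.mulVec_sum, Matrix.mulVec_sum]
  abel

/-- The subtracted pairs have positive degrees with sum at most `k + 1`. Grouping them by the first
degree and replacing each inner partial sum by `x` minus a remainder puts a remainder of order at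
most `k` in every surviving term. -/
theorem tensorSq_sub_sum_homTensor (hu : u 0 = 0) (k : ℕ) (t : ℝ) :
    tensorSq (x t) - ∑ a ∈ Finset.range (k + 2), homTensor u a t =
      (∑ i ∈ Finset.range k, fun p : Fin n × Fin n =>
        u (i + 1) t p.1 * remainder x u (k - i) t p.2) +
      fun p : Fin n × Fin n => remainder x u k t p.1 * x t p.2 := by
  funext p
  have h1 : ∑ a ∈ Finset.range (k + 2), homTensor u a t p = ∑ i ∈ Finset.range k,
      u (i + 1) t p.1 * ∑ b ∈ Finset.range (k - i + 1), u b t p.2 := by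
    simp only [homTensor, Finset.Nat.sum_antidiagonal_eq_sum_range_succ
      (fun a b => u a t p.1 * u b t p.2), Nat.succ_eq_add_one]
    rw [Finset.sum_range_diag_flip (k + 2) (fun a b => u a t p.1 * u b t p.2),
      Finset.sum_range_succ', Finset.sum_range_succ]
    simp only [← Finset.mul_sum]
    have h2 : k + 2 - (k + 1) = 1 := by omega
    rw [h2]
    simp only [hu, Finset.sum_range_one, Pi.zero_apply, mul_zero, zero_mul, add_zero]
    refine Finset.sum_congr rfl fun i hi => ?_
    have h3 : k + 2 - (i + 1) = k - i + 1 := by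
      have := Finset.mem_range.1 hi
      omega
    rw [h3]
  have h4 : ∑ i ∈ Finset.range k, u (i + 1) t p.1 = x t p.1 - remainder x u k t p.1 := by
    simp [remainder, Finset.sum_range_succ', hu]
  simp only [Pi.sub_apply, Pi.add_apply, Finset.sum_apply, h1, tensorSq]
  have h5 : ∀ i, ∑ b ∈ Finset.range (k - i + 1), u b t p.2 =
      x t p.2 - remainder x u (k - i) t p.2 := by
    intro i
    simp [remainder]
  simp only [h5, mul_sub, Finset.sum_sub_distrib, ← Finset.sum_mul, h4]
  ring

theorem vecNorm1_homTensor_le (hu : u 0 = 0) (k : ℕ) (t : ℝ) :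
    vecNorm1 (homTensor u (k + 2) t) ≤
      ∑ i ∈ Finset.range (k + 1), vecNorm1 (u (i + 1) t) * vecNorm1 (u (k - i + 1) t) := by
  have h1 : homTensor u (k + 2) t = ∑ i ∈ Finset.range (k + 1),
      fun p : Fin n × Fin n => u (i + 1) t p.1 * u (k - i + 1) t p.2 := by
    funext p
    rw [homTensor, Finset.Nat.sum_antidiagonal_eq_sum_range_succ
      (fun a b => u a t p.1 * u b t p.2), Nat.succ_eq_add_one, Finset.sum_range_succ,
      Finset.sum_range_succ', Finset.sum_apply]
    simp only [hu, Nat.sub_self, Pi.zero_apply, mul_zero, zero_mul, add_zero]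
    refine Finset.sum_congr rfl fun i hi => ?_
    have h3 : k + 2 - (i + 1) = k - i + 1 := by
      have := Finset.mem_range.1 hi
      omega
    rw [h3]
  rw [h1]
  refine (vecNorm1_sum_le _ _).trans (le_of_eq (Finset.sum_congr rfl fun i _ => ?_))
  exact vecNorm1_tensor (u (i + 1) t) (u (k - i + 1) t)

theorem vecNorm1_taylor_le (hW : IsUnit W.det)
    (hF₁ : F₁.map (fun r : ℝ => (r : ℂ)) = W * Matrix.diagonal lam * W⁻¹)
    (hγ : 0 < γ) (hre : ∀ k, (lam k).re ≤ -γ)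
    (hu : IsTaylorFlow F₁ F₂ xin N u) (hν : ∀ t ∈ Set.Icc 0 T, vecNorm1 (u 1 t) ≤ ν) (i : ℕ)
    (hi : i + 1 ≤ N) {t : ℝ} (ht : t ∈ Set.Icc 0 T) :
    vecNorm1 (u (i + 1) t) ≤
      catalan i * (condNum1 W * matNorm1 F₂ / γ) ^ i * ν ^ (i + 1) := by
  set β := condNum1 W * matNorm1 F₂ / γ with hβ
  have hβ0 : 0 ≤ β := div_nonneg (mul_nonneg (condNum1_nonneg W) (matNorm1_nonneg _)) hγ.le
  have hν0 : 0 ≤ ν := (vecNorm1_nonneg _).trans (hν t ht)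
  induction i using Nat.strong_induction_on generalizing t with
  | _ i ih =>
  rcases i with _ | i
  · simpa using hν t ht
  · refine (vecNorm1_le_div_of_hasDerivWithinAt hW hF₁ hγ hre
      (G := matNorm1 F₂ * (catalan (i + 1) * β ^ i * ν ^ (i + 2)))
      (fun s _ => (hu.deriv (i + 2) hi s).hasDerivWithinAt) (fun s hs => ?_)
      (hu.init (i + 2) (by omega) hi) ht).trans (le_of_eq ?_)
    · refine (vecNorm1_mulVec_le _ _).trans (mul_le_mul_of_nonneg_left ?_ (matNorm1_nonneg _))
      refine (vecNorm1_homTensor_le hu.zero i s).trans ?_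
      rw [catalan_succ_eq_sum_range, Finset.sum_mul, Finset.sum_mul]
      refine Finset.sum_le_sum fun j hj => ?_
      have hj' := Finset.mem_range.1 hj
      calc _ ≤ (catalan j * β ^ j * ν ^ (j + 1)) *
            (catalan (i - j) * β ^ (i - j) * ν ^ (i - j + 1)) :=
            mul_le_mul (ih j (by omega) (by omega) hs) (ih (i - j) (by omega) (by omega) hs)
              (vecNorm1_nonneg _) (by positivity)
        _ = catalan j * catalan (i - j) * (β ^ j * β ^ (i - j)) *
            (ν ^ (j + 1) * ν ^ (i - j + 1)) := by ring
        _ = _ := by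
            rw [← pow_add, ← pow_add, Nat.add_sub_cancel' (by omega : j ≤ i),
              show j + 1 + (i - j + 1) = i + 2 by omega]
    · rw [pow_succ β i, hβ]
      ring

theorem vecNorm1_remainder_le (hW : IsUnit W.det)
    (hF₁ : F₁.map (fun r : ℝ => (r : ℂ)) = W * Matrix.diagonal lam * W⁻¹)
    (hγ : 0 < γ) (hre : ∀ k, (lam k).re ≤ -γ) (hx : IsQuadraticSolution F₁ F₂ xin T x)
    (hμ : ∀ t ∈ Set.Icc 0 T, vecNorm1 (x t) ≤ μ) (hT : 0 ≤ T)
    (hu : IsTaylorFlow F₁ F₂ xin N u) (hν : ∀ t ∈ Set.Icc 0 T, vecNorm1 (u 1 t) ≤ ν)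
    (hμν : μ ≤ ν) (k : ℕ) (hk : k + 1 ≤ N) {t : ℝ} (ht : t ∈ Set.Icc 0 T) :
    vecNorm1 (remainder x u (k + 1) t) ≤ errConst W F₂ μ * T * catalan (k + 1) *
      (condNum1 W * matNorm1 F₂ / γ * ν) ^ k := by
  have hκ := condNum1_nonneg W
  have hF₂ := matNorm1_nonneg F₂
  set β := condNum1 W * matNorm1 F₂ / γ with hβ
  have hβ0 : 0 ≤ β := div_nonneg (mul_nonneg hκ hF₂) hγ.le
  have hμ0 : 0 ≤ μ := (vecNorm1_nonneg _).trans (hμ t ht)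
  have hν0 : 0 ≤ ν := hμ0.trans hμν
  have hD : 0 ≤ errConst W F₂ μ * T := by
    unfold errConst
    positivity
  induction k using Nat.strong_induction_on generalizing t with
  | _ k ih =>
  rcases k with _ | k
  · refine (vecNorm1_le_mul_of_hasDerivWithinAt hW hF₁ hγ hre (G := matNorm1 F₂ * μ ^ 2)
      (fun s hs => remainder_hasDerivWithinAt hx hu hk hs) (fun s hs => ?_)
      (remainder_initial hx hu hk) ht).trans (le_of_eq ?_)
    · refine (vecNorm1_mulVec_le _ _).trans (mul_le_mul_of_nonneg_left ?_ hF₂)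
      rw [tensorSq_sub_sum_homTensor hu.zero, Finset.sum_range_zero, zero_add, vecNorm1_tensor,
        remainder_zero hu.zero, sq]
      exact mul_le_mul (hμ s hs) (hμ s hs) (vecNorm1_nonneg _) hμ0
    · simp only [errConst, zero_add, catalan_one, Nat.cast_one, pow_zero]
      ring
  · refine (vecNorm1_le_div_of_hasDerivWithinAt hW hF₁ hγ hre
      (G := matNorm1 F₂ * (errConst W F₂ μ * T * catalan (k + 2) * (β * ν) ^ k * ν))
      (fun s hs => remainder_hasDerivWithinAt hx hu hk hs) (fun s hs => ?_)
      (remainder_initial hx hu hk) ht).trans (le_of_eq ?_)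
    · refine (vecNorm1_mulVec_le _ _).trans (mul_le_mul_of_nonneg_left ?_ hF₂)
      rw [tensorSq_sub_sum_homTensor hu.zero]
      refine (vecNorm1_add_le _ _).trans ?_
      -- The last Catalan summand, with factor `catalan 0 = 1`, pays for the term `remainder ⊗ x`;
      -- there `x` is bounded by `ν` through `μ ≤ ν`. The other summands match the terms `u ⊗
      -- remainder`.
      rw [catalan_succ_eq_sum_range, Finset.sum_range_succ _ (k + 1), Nat.sub_self, catalan_zero,
        Nat.cast_one, mul_one, mul_add, add_mul, add_mul]
      refine add_le_add ((vecNorm1_sum_le _ _).trans ?_) ?_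
      · rw [Finset.mul_sum, Finset.sum_mul, Finset.sum_mul]
        refine Finset.sum_le_sum fun j hj => ?_
        have hj' := Finset.mem_range.1 hj
        obtain ⟨l, rfl⟩ : ∃ l, k = j + l := ⟨k - j, by omega⟩
        have hl : j + l + 1 - j = l + 1 := by omega
        rw [hl]
        refine (vecNorm1_tensor (u (j + 1) s) (remainder x u (l + 1) s)).trans_le ?_
        calc _ ≤ (catalan j * β ^ j * ν ^ (j + 1)) *
              (errConst W F₂ μ * T * catalan (l + 1) * (β * ν) ^ l) :=
              mul_le_mul (vecNorm1_taylor_le hW hF₁ hγ hre hu hν j (by omega) hs)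
                (ih l (by omega) (by omega) hs) (vecNorm1_nonneg _) (by positivity)
          _ = _ := by ring
      · rw [vecNorm1_tensor]
        exact mul_le_mul (ih k (by omega) (by omega) hs) ((hμ s hs).trans hμν)
          (vecNorm1_nonneg _) (by positivity)
    · rw [pow_succ _ k, hβ]
      ring

theorem vecNorm1_sub_firstBlock_le (hW : IsUnit W.det)
    (hF₁ : F₁.map (fun r : ℝ => (r : ℂ)) = W * Matrix.diagonal lam * W⁻¹)
    (hγ : 0 < γ) (hre : ∀ k, (lam k).re ≤ -γ) (hx : IsQuadraticSolution F₁ F₂ xin T x)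
    (hμ : ∀ t ∈ Set.Icc 0 T, vecNorm1 (x t) ≤ μ) (hT : 0 ≤ T) (hN : 1 ≤ N)
    (hu : IsTaylorFlow F₁ F₂ xin N u) (hν : ∀ t ∈ Set.Icc 0 T, vecNorm1 (u 1 t) ≤ ν)
    (hμν : μ ≤ ν) {y : (j : ℕ) → ℝ → (Fin j → Fin n) → ℝ}
    (hy : IsCarlemanSolution F₁ F₂ xin N T y) {r : ℝ}
    (hr : 4 * (condNum1 W * matNorm1 F₂ / γ * ν) ≤ r) :
    vecNorm1 (x T - firstBlock y T) ≤ N * errConst W F₂ μ * T * r ^ (N - 1) := by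
  have hTT : T ∈ Set.Icc 0 T := Set.right_mem_Icc.2 hT
  have hκ := condNum1_nonneg W
  have hF₂ := matNorm1_nonneg F₂
  have hμ0 : 0 ≤ μ := (vecNorm1_nonneg _).trans (hμ T hTT)
  have hν0 : 0 ≤ ν := hμ0.trans hμν
  obtain ⟨k, rfl⟩ : ∃ k, N = k + 1 := ⟨N - 1, by omega⟩
  rw [hy.firstBlock_eq hu hN hTT]
  have hq : 0 ≤ condNum1 W * matNorm1 F₂ / γ * ν := by positivity
  have hD : 0 ≤ errConst W F₂ μ * T := by
    unfold errConst
    positivity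
  calc _ ≤ errConst W F₂ μ * T * catalan (k + 1) * (condNum1 W * matNorm1 F₂ / γ * ν) ^ k :=
        vecNorm1_remainder_le hW hF₁ hγ hre hx hμ hT hu hν hμν k le_rfl hTT
    _ ≤ errConst W F₂ μ * T * 4 ^ k * (condNum1 W * matNorm1 F₂ / γ * ν) ^ k := by
        have := catalan_succ_le_four_pow k
        gcongr
        exact_mod_cast this
    _ = 1 * (errConst W F₂ μ * T) * (4 * (condNum1 W * matNorm1 F₂ / γ * ν)) ^ k := by
        rw [mul_pow]
        ring
    -- The estimate so far has no factor `N`; it is slack inserted here.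
    _ ≤ ((k + 1 : ℕ) : ℝ) * (errConst W F₂ μ * T) * r ^ k := by
        have h1 : (1 : ℝ) ≤ ((k + 1 : ℕ) : ℝ) := by
          push_cast
          linarith [(Nat.cast_nonneg k : (0 : ℝ) ≤ k)]
        gcongr
    _ = _ := by
        rw [Nat.add_sub_cancel]
        ring

end Bounds

end Carleman

/-! ### The two error bounds. -/

theorem mainTheorem1 {n N : ℕ} (hN : 1 ≤ N)
    (F₁ : Matrix (Fin n) (Fin n) ℝ) (F₂ : Matrix (Fin n) (Fin n × Fin n) ℝ)
    (W : Matrix (Fin n) (Fin n) ℂ) (lam : Fin n → ℂ)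
    (hW : IsUnit W.det)
    (hF₁ : F₁.map (fun r : ℝ => (r : ℂ)) = W * Matrix.diagonal lam * W⁻¹)
    (hre : ∀ k, (lam k).re ≤ 0)
    (hΔ : 0 < Carleman.resonanceParam lam)
    (T μ : ℝ) (hT : 0 ≤ T) (xin : Fin n → ℝ)
    (x : ℝ → Fin n → ℝ) (hx : Carleman.IsQuadraticSolution F₁ F₂ xin T x)
    (hμ : ∀ t ∈ Set.Icc 0 T, Carleman.vecNorm1 (x t) ≤ μ)
    (y : (j : ℕ) → ℝ → (Fin j → Fin n) → ℝ)
    (hy : Carleman.IsCarlemanSolution F₁ F₂ xin N T y) :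
    (Carleman.resRate W lam F₂ μ ≤ 1 →
      Carleman.vecNorm1 (x T - Carleman.firstBlock y T) ≤
        N * Carleman.errConst W F₂ μ * T * Carleman.resRate W lam F₂ μ ^ (N - 1)) ∧
    Carleman.vecNorm1 (x T - Carleman.firstBlock y T) ≤
      N * Carleman.errConst W F₂ μ * T *
        (Carleman.condNum1 W * Carleman.resRate W lam F₂ μ) ^ (N - 1) := by
  have hn : 0 < n := by
    rcases Nat.eq_zero_or_pos n with rfl | h
    -- For `n = 0` the infimum is over the empty set, hence 0 by convention, against `Δ > 0`.
    · simp [Carleman.resonanceParam] at hΔ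
    · exact h
  obtain ⟨u, hu⟩ := Carleman.exists_isTaylorFlow F₁ F₂ xin N hN
  have hgap := Carleman.re_eigenvalue_le hW hF₁ hre
  have hγ : 0 < Carleman.resonanceParam lam / 2 := by positivity
  have h0 : (0 : ℝ) ∈ Set.Icc 0 T := Set.left_mem_Icc.2 hT
  have hμ0 : 0 ≤ μ := (Carleman.vecNorm1_nonneg _).trans (hμ 0 h0)
  have hκ := Carleman.condNum1_nonneg W
  have hκ1 := Carleman.one_le_condNum1 hn W hW
  have hF₂ := Carleman.matNorm1_nonneg F₂
  have he : 2.7 ≤ Real.exp 1 := by linarith [Real.exp_one_gt_d9]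
  set κ := Carleman.condNum1 W
  set β := κ * Carleman.matNorm1 F₂ / (Carleman.resonanceParam lam / 2) with hβ
  have hβ0 : 0 ≤ β := by positivity
  have hrate : Carleman.resRate W lam F₂ μ = 2 * Real.exp 1 * (β * μ) := by
    rw [Carleman.resRate, hβ]
    field_simp
    ring
  constructor
  · intro hR
    -- Here `u 1` is `x` minus the first remainder, and the latter is at most `β μ²` uniformly in
    -- time; this avoids the factor `κ` of the direct bound on `u 1`.
    refine Carleman.vecNorm1_sub_firstBlock_le (ν := μ + β * μ ^ 2) hW hF₁ hγ hgap hx hμ hT hN hu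
      (fun t ht => ?_) (by nlinarith [mul_nonneg hβ0 (sq_nonneg μ)]) hy ?_
    · have h1 : u 1 t = x t - Carleman.remainder x u 1 t := by
        simp [Carleman.remainder, Finset.sum_range_succ, hu.zero]
      rw [h1]
      refine (Carleman.vecNorm1_sub_le _ _).trans (add_le_add (hμ t ht) ?_)
      refine (Carleman.vecNorm1_le_div_of_hasDerivWithinAt hW hF₁ hγ hgap
        (G := Carleman.matNorm1 F₂ * μ ^ 2)
        (fun s hs => Carleman.remainder_hasDerivWithinAt hx hu hN hs) (fun s hs => ?_)
        (Carleman.remainder_initial hx hu hN) ht).trans (le_of_eq ?_)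
      · refine (Carleman.vecNorm1_mulVec_le _ _).trans (mul_le_mul_of_nonneg_left ?_ hF₂)
        rw [Carleman.tensorSq_sub_sum_homTensor hu.zero, Finset.sum_range_zero, zero_add,
          Carleman.vecNorm1_tensor, Carleman.remainder_zero hu.zero, sq]
        exact mul_le_mul (hμ s hs) (hμ s hs) (Carleman.vecNorm1_nonneg _) hμ0
      · rw [hβ]
        ring
    · rw [hrate] at hR ⊢
      have hb : 0 ≤ β * μ := mul_nonneg hβ0 hμ0
      -- From `2e βμ ≤ 1` and `e ≥ 2.7`. Then `4(1 + βμ) ≤ 4.8 ≤ 2e`, which is the room the constant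
      -- `4e` in the rate provides.
      have hb1 : β * μ ≤ 0.2 := by nlinarith
      calc 4 * (β * (μ + β * μ ^ 2)) = 4 * (1 + β * μ) * (β * μ) := by ring
        _ ≤ 2 * Real.exp 1 * (β * μ) := mul_le_mul_of_nonneg_right (by linarith) hb
  -- Without smallness, `u 1` is bounded as a solution of the homogeneous linear equation, at the
  -- cost of one `κ` in the rate; `4 ≤ 2e` then suffices.
  · refine Carleman.vecNorm1_sub_firstBlock_le (ν := κ * μ) hW hF₁ hγ hgap hx hμ hT hN hu
      (fun t ht => ?_) (le_mul_of_one_le_left hμ0 hκ1) hy ?_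
    · have h1 := Carleman.vecNorm1_le_of_hasDerivWithinAt hW hF₁ hγ hgap (T := T) (v := u 1)
        (g := fun _ => 0) (G := 0) (fun s _ => ?_) (fun s _ => Carleman.vecNorm1_zero.le) ht
      · rw [hu.init_one, ← hx.1, mul_zero, zero_mul, add_zero] at h1
        exact h1.trans (mul_le_mul_of_nonneg_left (hμ 0 h0) hκ)
      · refine (hu.deriv 1 hN s).hasDerivWithinAt.congr_deriv ?_
        have h2 : Carleman.homTensor u 1 s = 0 := by
          funext p
          simp [Carleman.homTensor, Finset.Nat.antidiagonal_succ, hu.zero]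
        rw [h2, Matrix.mulVec_zero]
    · rw [hrate]
      have hb : 0 ≤ β * (κ * μ) := by positivity
      calc 4 * (β * (κ * μ)) ≤ 2 * Real.exp 1 * (β * (κ * μ)) := by nlinarith
        _ = _ := by ring
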